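/- Setting. Let $S,A,\mathcal L,\Sigma$ be finite sets of domain states, domain actions, levels of autonomy and feedback signals, let $\mathcal L$ carry a graph structure (adjacent levels), and put $\overline S=S\times\mathcal L$, $\overline A=A\times\mathcal L$. A feedback profile is a map $\lambda:\overline S\times\overline A\to\Delta^{|\Sigma|}$; an autonomy profile is a map $\kappa:S\times A\to\mathcal P(\mathcal L)$. A competence-aware system (CAS) $\mathcal S$ consists of an initial factored state, a goal $s_g\in S$, next-state distributions $T_l^{\sigma}(s,a,\cdot)$ for each level $l$ and signal $\sigma$, and a cost $\overline C=g(C,\mu,\rho)$ which aggregates the domain cost $C\ge 0$, the cost of autonomy $\mu$ and the human cost $\rho\ge 0$ and is positive outside the goal. In $\overline s=(s,l)$ the action $\overline a=(a,l')$ leads to $(s',l')$ with probability $\overline T_\lambda(\overline s,\overline a,(s',l'))=\sum_{\sigma}\lambda(\sigma\mid\overline s,\overline a)\,T_{l'}^{\sigma}(s,a,s')$; the goal is terminal and free of cost. A policy $\pi:\overline S\to\overline A$ is allowed by $\kappa$ if $\pi(s,l)=(a,l')$ implies $l'\in\kappa(s,a)$; $V^\pi_\lambda(\overline s)\in[0,\infty]$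 is its expected cumulative cost, $V^*_{\lambda,\kappa}$ is the minimum over the policies allowed by $\kappa$, and an optimal policy $\pi^*$ for $(\lambda,\kappa)$ is an allowed policy of least value at every factored state. Let $q_{\lambda,\kappa}(\overline s,\overline a)=\overline C(\overline s,\overline a)+\sum_{\overline s'}\overline T_\lambda(\overline s,\overline a,\overline s')V^*_{\lambda,\kappa}(\overline s')$. The human has a stationary feedback distribution $\lambda^{\mathcal H}$ and grants a query to perform $a$ in $s$ at level $l$ with a fixed probability $h(s,a,l)$, and $\kappa^{\mathcal H}(s,a)=\{l: h(s,a,l)>0\}$. The competence $\chi_{\mathcal S}(\overline s,a)$ is the set of minimizers $l\in\mathcal L$ of $q(\overline s,(a,l))$ for $\lambda^{\mathcal H}$ and unrestricted policies (a single level if the minimizer is unique). The system with profiles $(\lambda,\kappa)$ is level-optimal if an optimal policy exists and every optimal policy $\pi^*$ satisfies: for all $\overline s\in\overline S$, $\pi^*(\overline s)=(a,l)$ with $l\in\chi_{\mathcal S}(\overline s,a)$. Gated exploration with parameter $\eta\in(0,1]$: at step $t$ the system, with current profiles $\lambda_t,\kappa_t$, performs some action $a$ in some factored state $\overline s=(s,l)$.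 Given the past, it proposes each level $l'$ adjacent to the current level $l$ with probability $\eta\,e^{-q(\overline s,(a,l'))}/\sum_{l''\sim l}e^{-q(\overline s,(a,l''))}$, where $q=q_{\lambda_t,\kappa_t}$; otherwise it proposes nothing. If the proposed level is not in $\kappa_t(s,a)$, the human is queried, and grants it with conditional probability $h(s,a,l')$; a granted level is added to $\kappa_t(s,a)$, and otherwise $\kappa$ does not change. The system operates at the proposed level if it is allowed or granted, and otherwise at a level in $\kappa_t(s,a)$ of least $q_{\lambda_t,\kappa_t}(\overline s,(a,\cdot))$. It then receives a signal with conditional distribution $\lambda^{\mathcal H}$. The profile $\lambda_{t}$ may be estimated from the past in any way, and the successive pairs $(\overline s,a)$ may arise in any (non-anticipating) way. Theorem. Let $\mathcal S$ be a CAS that follows gated exploration from an initial autonomy profile $\kappa_0$ and an arbitrary initial feedback profile $\lambda_0$, where for every feedback profile some policy allowed by $\kappa_0$ has finite value at every factored state. Assume that for every $\overline s=(s,l)\in\overline S$ with $s\ne s_g$ and every $a\in A$ there is a path in the graph $\mathcal L$ from a level in $\kappa_0(s,a)$ to a level in $\chi_{\mathcal S}(\overline s,a)$, all of whose levels are in $\kappa^{\mathcal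 H}(s,a)$. Assume that almost surely no $(\overline s,a)$ with $\overline s=(s,l)$, $s\neq s_g$, is starved, i.e. if $l\in\kappa_t(s,a)$ for some $t$, then $a$ is performed in $\overline s$ infinitely often; and that $\{\lambda_t\}$ converges in distribution to $\lambda^{\mathcal H}$, in the sense that $\lambda_t(\cdot\mid\overline s,(a,l'))$ converges in distribution to $\lambda^{\mathcal H}(\cdot\mid\overline s,(a,l'))$ for all $\overline s=(s,l)$ with $s\neq s_g$, all $a$, and all $l'\in\kappa_0(s,a)\cup\kappa^{\mathcal H}(s,a)$. Then $\mathcal S$ converges to level-optimality: the probability that the system with profiles $(\lambda_t,\kappa_t)$ is level-optimal tends to $1$ as $t\to\infty$. -/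

import Mathlib

open MeasureTheory ProbabilityTheory Filter Topology
open scoped ENNReal

/-- A feedback profile: `lam (s, l) (a, l')` is the distribution of the feedback signal that the
human gives when action `a` is performed at level `l'` in domain state `s`, the system having just
operated at level `l`. -/
abbrev FeedbackProfile (S A L Sig : Type*) [Fintype Sig] : Type _ :=
  S × L → A × L → stdSimplex ℝ Sig

/-- An autonomy profile: `κ s a` is the set of levels at which `a` may be performed in `s`. -/
abbrev AutonomyProfile (S A L : Type*) : Type _ := S → A → Set L

/-- A competence-aware system: domain states `S`, domain actions `A`, levels of autonomy `L` and
feedback signals `Sig`. The factored states are `S × L`, the factored actions are `A × L`. The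
profiles `λ` and `κ`, which vary over time, are kept outside of the structure. -/
structure CAS (S A L Sig : Type*) [Fintype S] where
  /-- The graph of levels: the level can change from one to the other along an edge. -/
  graph : SimpleGraph L
  /-- `trans l σ s a` is the distribution of the next domain state when `a` is performed in `s` at
  level `l` and the human responds with the signal `σ`. (For example: the domain dynamics after an
  approval, the human's dynamics after an override, staying in `s` after a disapproval.) -/
  trans : L → Sig → S → A → stdSimplex ℝ S
  /-- domain cost -/
  domainCost : S → A → ℝ
  /-- cost of autonomy -/
  autonomyCost : S × L → A × L → ℝ
  /-- cost to the human -/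
  humanCost : S × L → A × L → ℝ
  /-- cost aggregation function -/
  aggregate : ℝ → ℝ → ℝ → ℝ
  /-- initial factored state -/
  start : S × L
  /-- domain goal state -/
  goal : S
  domainCost_nonneg : ∀ s a, 0 ≤ domainCost s a
  humanCost_nonneg : ∀ x u, 0 ≤ humanCost x u
  /-- The aggregated cost is positive outside of the goal. -/
  aggregate_pos : ∀ x u, x.1 ≠ goal →
    0 < aggregate (domainCost x.1 u.1) (autonomyCost x u) (humanCost x u)

/-- The human authority: the true stationary distribution of the feedback signals, and the
probability that a query for permission to perform `a` in `s` at level `l` is granted. -/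
structure Human (S A L Sig : Type*) [Fintype Sig] where
  feedback : FeedbackProfile S A L Sig
  allow : S → A → L → ℝ
  allow_nonneg : ∀ s a l, 0 ≤ allow s a l
  allow_le_one : ∀ s a l, allow s a l ≤ 1

/-- The levels that the human allows with nonzero probability. -/
def Human.kappaH {S A L Sig : Type*} [Fintype Sig] (H : Human S A L Sig) : AutonomyProfile S A L :=
  fun s a => {l | 0 < H.allow s a l}

namespace CAS

variable {S A L Sig : Type*} [Fintype S] [Fintype A] [Fintype L] [Fintype Sig]

open Classical in
/-- The transition function on factored states under the profile `lam`. The signal is distributed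
according to `lam`, the next domain state according to `trans`, and the level component of the
next factored state is the level just used. The goal is terminal. -/
noncomputable def transition (C : CAS S A L Sig) (lam : FeedbackProfile S A L Sig)
    (x : S × L) (u : A × L) (y : S × L) : ℝ :=
  if y.2 = u.2 then
    (if x.1 = C.goal then (if y.1 = C.goal then 1 else 0)
      else ∑ σ, (lam x u : Sig → ℝ) σ * (C.trans u.2 σ x.1 u.1 : S → ℝ) y.1)
  else 0

open Classical in
/-- The cost function on factored states and actions; no cost is incurred at the goal. -/
noncomputable def cost (C : CAS S A L Sig) (x : S × L) (u : A × L) : ℝ :=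
  if x.1 = C.goal then 0
  else C.aggregate (C.domainCost x.1 u.1) (C.autonomyCost x u) (C.humanCost x u)

/-- Expected cost of the first `n` steps of the policy `π` from `x` when the feedback follows
`lam`. -/
noncomputable def stepValue (C : CAS S A L Sig) (lam : FeedbackProfile S A L Sig)
    (π : S × L → A × L) : ℕ → S × L → ℝ≥0∞
  | 0, _ => 0
  | n + 1, x => ENNReal.ofReal (C.cost x (π x)) +
      ∑ y, ENNReal.ofReal (C.transition lam x (π x) y) * C.stepValue lam π n y

/-- Expected cumulative cost of the policy `π` from `x` when the feedback follows `lam`, the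
limit of the (nondecreasing) expected costs of the first `n` steps; it may be infinite. -/
noncomputable def value (C : CAS S A L Sig) (lam : FeedbackProfile S A L Sig)
    (π : S × L → A × L) (x : S × L) : ℝ≥0∞ :=
  ⨆ n : ℕ, C.stepValue lam π n x

/-- The policies that are allowed by the autonomy profile `κ`. -/
def allowed (κ : AutonomyProfile S A L) : Set (S × L → A × L) :=
  {π | ∀ x, (π x).2 ∈ κ x.1 (π x).1}

/-- Optimal policies, given `lam`, among those allowed by `κ`: of least value at every state. -/
def IsOptimal (C : CAS S A L Sig) (lam : FeedbackProfile S A L Sig) (κ : AutonomyProfile S A L)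
    (π : S × L → A × L) : Prop :=
  π ∈ allowed κ ∧ ∀ π' ∈ allowed κ, ∀ x, C.value lam π x ≤ C.value lam π' x

/-- The least value attainable from `x` by policies allowed by `κ`. -/
noncomputable def optValue (C : CAS S A L Sig) (lam : FeedbackProfile S A L Sig)
    (κ : AutonomyProfile S A L) (x : S × L) : ℝ≥0∞ :=
  ⨅ π ∈ allowed κ, C.value lam π x

/-- The expected cost of taking the factored action `u` in `x` and then behaving optimally, under
`lam`, among the policies allowed by `κ`. -/
noncomputable def qValue (C : CAS S A L Sig) (lam : FeedbackProfile S A L Sig)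
    (κ : AutonomyProfile S A L) (x : S × L) (u : A × L) : ℝ≥0∞ :=
  ENNReal.ofReal (C.cost x u) +
    ∑ y, ENNReal.ofReal (C.transition lam x u y) * C.optValue lam κ y

/-- The competence: the levels of least expected cost for performing `a` in `x` (among all levels,
with optimal unrestricted continuation), given the true feedback distribution. It is a set, since
the minimum may be attained more than once. -/
def competence (C : CAS S A L Sig) (H : Human S A L Sig) (x : S × L) (a : A) : Set L :=
  {l | ∀ l', C.qValue H.feedback (fun _ _ => Set.univ) x (a, l) ≤
    C.qValue H.feedback (fun _ _ => Set.univ) x (a, l')}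

/-- Level-optimality of the system with current profiles `lam` and `κ`: it has an optimal policy,
and every optimal policy performs, at every factored state, the action it chooses at a level of
competence. -/
def LevelOptimal (C : CAS S A L Sig) (H : Human S A L Sig) (lam : FeedbackProfile S A L Sig)
    (κ : AutonomyProfile S A L) : Prop :=
  (∃ π, C.IsOptimal lam κ π) ∧
    ∀ π, C.IsOptimal lam κ π → ∀ x, (π x).2 ∈ C.competence H x (π x).1

/-- Under every feedback profile, some policy allowed by `κ` has finite expected cost from every
state. -/
def WellPosed (C : CAS S A L Sig) (κ : AutonomyProfile S A L) : Prop :=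
  ∀ lam : FeedbackProfile S A L Sig, ∃ π ∈ allowed κ, ∀ x, C.value lam π x ≠ ⊤

open Classical in
/-- The probability that the gated exploration strategy proposes to explore level `l'` when `a` is
performed in `x = (s, l)`: proportional, with factor `η`, to the softmax of the negative `q`-value
over the levels adjacent to the current level `l`. -/
noncomputable def exploreProb (C : CAS S A L Sig) (η : ℝ) (lam : FeedbackProfile S A L Sig)
    (κ : AutonomyProfile S A L) (x : S × L) (a : A) (l' : L) : ℝ :=
  if C.graph.Adj x.2 l' then
    η * (Real.exp (-(C.qValue lam κ x (a, l')).toReal) /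
      ∑ l'' with C.graph.Adj x.2 l'', Real.exp (-(C.qValue lam κ x (a, l'')).toReal))
  else 0

end CAS

/-- The random quantities recorded while a system is operating, at steps `t = 0, 1, 2, …`. -/
structure RunData (S A L Sig Ω : Type*) [Fintype Sig] where
  /-- the current factored state -/
  state : ℕ → Ω → S × L
  /-- the domain action performed -/
  act : ℕ → Ω → A
  /-- the feedback profile learned so far -/
  lam : ℕ → Ω → FeedbackProfile S A L Sig
  /-- the level used if nothing new is explored -/
  exploit : ℕ → Ω → L
  /-- the level proposed for exploration, if any -/
  propose : ℕ → Ω → Option L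
  /-- the human's answer if permission for the proposed level is requested -/
  answer : ℕ → Ω → Bool
  /-- the feedback signal received -/
  signal : ℕ → Ω → Sig

namespace RunData

variable {S A L Sig Ω : Type*} [Fintype Sig]

/-- The autonomy profile at time `t`: starting from `κ₀`, a proposed level is added as soon as the
human permits it, and nothing else changes. -/
def kappa (R : RunData S A L Sig Ω) (κ₀ : AutonomyProfile S A L) :
    ℕ → Ω → AutonomyProfile S A L
  | 0, _ => κ₀
  | t + 1, ω => fun s a => {l | l ∈ R.kappa κ₀ t ω s a ∨
      ((R.state t ω).1 = s ∧ R.act t ω = a ∧ R.propose t ω = some l ∧ R.answer t ω = true)}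

open Classical in
/-- The level at which the system operates at time `t`: the proposed level if it is already
allowed or the human permits it, and the exploitation level otherwise. -/
noncomputable def level (R : RunData S A L Sig Ω) (κ₀ : AutonomyProfile S A L) (t : ℕ) (ω : Ω) :
    L :=
  match R.propose t ω with
  | none => R.exploit t ω
  | some l =>
    if l ∈ R.kappa κ₀ t ω (R.state t ω).1 (R.act t ω) ∨ R.answer t ω = true then l
    else R.exploit t ω

/-- The pair of the factored state `(s, l)` and the action `a` is not starved along `ω`: if `l` is
ever an allowed level for `(s, a)`, then the system performs `a` in `(s, l)` infinitely often. -/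
def NotStarved (R : RunData S A L Sig Ω) (κ₀ : AutonomyProfile S A L) (ω : Ω)
    (x : S × L) (a : A) : Prop :=
  (∃ t, x.2 ∈ R.kappa κ₀ t ω x.1 a) → ∃ᶠ t in atTop, R.state t ω = x ∧ R.act t ω = a

end RunData

/-- `IsGatedRun C H η κ₀ lam₀ μ R`: the random run `R` is one of the system `C`, with initial
profiles `κ₀` and `lam₀`, that interacts with the human `H` and follows gated exploration.
How the successive pairs of states and actions arise (transitions, restarts with new tasks,
choice of actions) and how `lam` is estimated from the past are left completely open. -/
structure IsGatedRun {S A L Sig Ω : Type*} [Fintype S] [Fintype A] [Fintype L] [Fintype Sig]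
    [mΩ : MeasurableSpace Ω] (C : CAS S A L Sig) (H : Human S A L Sig) (η : ℝ)
    (κ₀ : AutonomyProfile S A L) (lam₀ : FeedbackProfile S A L Sig) (μ : Measure Ω)
    (R : RunData S A L Sig Ω) : Prop where
  /-- The feedback profile is initially `lam₀`. -/
  lam_zero : ∀ ω, R.lam 0 ω = lam₀
  /-- The exploitation level is an allowed level of least expected cost according to the current
  profiles (if any level is allowed). -/
  exploit_spec : ∀ t ω, ∀ l ∈ R.kappa κ₀ t ω (R.state t ω).1 (R.act t ω),
    R.exploit t ω ∈ R.kappa κ₀ t ω (R.state t ω).1 (R.act t ω) ∧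
    C.qValue (R.lam t ω) (R.kappa κ₀ t ω) (R.state t ω) (R.act t ω, R.exploit t ω) ≤
      C.qValue (R.lam t ω) (R.kappa κ₀ t ω) (R.state t ω) (R.act t ω, l)
  /-- There are increasing σ-algebras `ℱ t ≤ 𝒢 t ≤ ℋ t ≤ ℱ (t + 1)` of what is known, in step `t`,
  before the proposal, before the human's answer, and before the feedback signal. -/
  exists_history : ∃ ℱ 𝒢 ℋ : ℕ → MeasurableSpace Ω,
    (∀ t, ℱ t ≤ 𝒢 t ∧ 𝒢 t ≤ ℋ t ∧ ℋ t ≤ ℱ (t + 1) ∧ ℱ t ≤ mΩ ∧ 𝒢 t ≤ mΩ ∧ ℋ t ≤ mΩ) ∧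
    (∀ t x, MeasurableSet[ℱ t] {ω | R.state t ω = x}) ∧
    (∀ t a, MeasurableSet[ℱ t] {ω | R.act t ω = a}) ∧
    (∀ t, Measurable[ℱ t] (R.lam t)) ∧
    (∀ t l, MeasurableSet[ℱ t] {ω | R.exploit t ω = l}) ∧
    (∀ t l, MeasurableSet[𝒢 t] {ω | R.propose t ω = l}) ∧
    (∀ t b, MeasurableSet[ℋ t] {ω | R.answer t ω = b}) ∧
    (∀ t σ, MeasurableSet[ℱ (t + 1)] {ω | R.signal t ω = σ}) ∧
    -- proposals follow the exploration strategy
    (∀ t l, ∀ᵐ ω ∂μ, (μ⟦{ω' | R.propose t ω' = some l} | ℱ t⟧) ω =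
      C.exploreProb η (R.lam t ω) (R.kappa κ₀ t ω) (R.state t ω) (R.act t ω) l) ∧
    -- a disallowed level has to be permitted by the human
    (∀ t l, ∀ᵐ ω ∂μ, R.propose t ω = some l →
      l ∉ R.kappa κ₀ t ω (R.state t ω).1 (R.act t ω) →
      (μ⟦{ω' | R.answer t ω' = true} | 𝒢 t⟧) ω = H.allow (R.state t ω).1 (R.act t ω) l) ∧
    -- feedback signals follow the true distribution
    (∀ t σ, ∀ᵐ ω ∂μ, (μ⟦{ω' | R.signal t ω' = σ} | ℋ t⟧) ω =
      (H.feedback (R.state t ω) (R.act t ω, R.level κ₀ t ω) : Sig → ℝ) σ)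

/-! The argument separates into a deterministic statement about profiles near the limit and a
probabilistic one about the growth of `κ`, joined by a union bound.

Deterministic part: the value of a policy is lower semicontinuous in the feedback profile, as a
supremum of continuous finite-horizon costs (`eventually_lt_value`). Where finite, it is upper
semicontinuous: positive costs make `θ * V` with `θ > 1` a strict supersolution outside the goal,
and strictness survives perturbation (`eventually_value_le_mul`). There are finitely many policies,
so near the true feedback only truly optimal ones can be optimal (`eventually_isOptimal_imp`). If
every action outside the goal has an allowed level of competence, restricting to `κ` costs nothing,
so these policies use levels of competence (`IsOptimal.mem_competence`).

Probabilistic part: q-values are bounded by compactness, hence softmax probabilities are bounded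
below (`WellPosed.exists_le_exploreProb`). While an adjacent permissible level is missing, each
visit adds it with conditional probability at least some `c > 0`. It can be added only once, so the
visit probabilities sum to at most `1 / c`, and Borel–Cantelli leaves finitely many such visits
(`ae_eventually_mem_kappa`). Absence of starvation then propagates permission along the given paths
(`ae_exists_mem_kappa_of_walk`). -/

namespace CAS

/-! ### Dynamic programming for fixed profiles. -/

variable {S A L Sig : Type*} [Fintype S] [Fintype L] [Fintype Sig]

/-- The expected cost of taking the factored action `u` in `x` when the cost-to-go is `W`. -/
noncomputable def lookahead (C : CAS S A L Sig) (lam : FeedbackProfile S A L Sig)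
    (W : S × L → ℝ≥0∞) (x : S × L) (u : A × L) : ℝ≥0∞ :=
  ENNReal.ofReal (C.cost x u) + ∑ y, ENNReal.ofReal (C.transition lam x u y) * W y

lemma lookahead_mono (C : CAS S A L Sig) (lam : FeedbackProfile S A L Sig)
    {W W' : S × L → ℝ≥0∞} (h : ∀ y, W y ≤ W' y) (x : S × L) (u : A × L) :
    C.lookahead lam W x u ≤ C.lookahead lam W' x u := by
  unfold lookahead
  gcongr with y
  exact h y

lemma stepValue_le_succ (C : CAS S A L Sig) (lam : FeedbackProfile S A L Sig)
    (π : S × L → A × L) (n : ℕ) (x : S × L) :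
    C.stepValue lam π n x ≤ C.stepValue lam π (n + 1) x := by
  induction n generalizing x with
  | zero => simp [stepValue]
  | succ n ih => exact C.lookahead_mono lam ih x (π x)

lemma stepValue_mono (C : CAS S A L Sig) (lam : FeedbackProfile S A L Sig)
    (π : S × L → A × L) (x : S × L) : Monotone fun n => C.stepValue lam π n x :=
  monotone_nat_of_le_succ fun n => C.stepValue_le_succ lam π n x

/-- The Bellman equation of a policy. -/
lemma value_eq_lookahead (C : CAS S A L Sig) (lam : FeedbackProfile S A L Sig)
    (π : S × L → A × L) (x : S × L) :
    C.value lam π x = C.lookahead lam (C.value lam π) x (π x) := by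
  have h1 : C.value lam π x = ⨆ n, C.stepValue lam π (n + 1) x :=
    ((C.stepValue_mono lam π x).iSup_nat_add 1).symm
  rw [h1]
  simp only [stepValue, lookahead, value, ENNReal.mul_iSup]
  rw [ENNReal.finsetSum_iSup_of_monotone, ENNReal.add_iSup]
  intro y m n hmn
  exact mul_le_mul_right (C.stepValue_mono lam π y hmn) _

/-- Value iteration starts at zero, below every `W`, and the one-step operator is monotone, so all
iterates stay below a supersolution. No finiteness is needed. -/
lemma value_le_of_lookahead_le (C : CAS S A L Sig) {lam : FeedbackProfile S A L Sig}
    {π : S × L → A × L} {W : S × L → ℝ≥0∞} (h : ∀ x, C.lookahead lam W x (π x) ≤ W x)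
    (x : S × L) : C.value lam π x ≤ W x := by
  refine iSup_le fun n => ?_
  induction n generalizing x with
  | zero => simp [stepValue]
  | succ n ih => exact (C.lookahead_mono lam ih x (π x)).trans (h x)

lemma optValue_le_value (C : CAS S A L Sig) (lam : FeedbackProfile S A L Sig)
    {κ : AutonomyProfile S A L} {π : S × L → A × L} (h : π ∈ allowed κ) (x : S × L) :
    C.optValue lam κ x ≤ C.value lam π x :=
  iInf₂_le π h

lemma optValue_anti (C : CAS S A L Sig) (lam : FeedbackProfile S A L Sig)
    {κ κ' : AutonomyProfile S A L} (h : ∀ s a, κ s a ⊆ κ' s a) (x : S × L) :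
    C.optValue lam κ' x ≤ C.optValue lam κ x :=
  le_iInf₂ fun _ hπ => C.optValue_le_value lam (fun y => h _ _ (hπ y)) x

/-- A policy that is greedy with respect to the least values is optimal. -/
lemma value_eq_optValue_of_greedy (C : CAS S A L Sig) {lam : FeedbackProfile S A L Sig}
    {κ : AutonomyProfile S A L} {π : S × L → A × L} (hπ : π ∈ allowed κ)
    (h : ∀ x, C.qValue lam κ x (π x) ≤ C.optValue lam κ x) (x : S × L) :
    C.value lam π x = C.optValue lam κ x :=
  le_antisymm (C.value_le_of_lookahead_le h x) (C.optValue_le_value lam hπ x)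

/-- Finitely many policies give a minimizer for each state separately. Being allowed is a statewise
condition, so at each state one may take the choice of the minimizer for that state; its Bellman
equation gives the bound. -/
lemma exists_greedy [Finite A] (C : CAS S A L Sig) (lam : FeedbackProfile S A L Sig)
    {κ : AutonomyProfile S A L} (h : (allowed κ).Nonempty) :
    ∃ π ∈ allowed κ, ∀ x, C.qValue lam κ x (π x) ≤ C.optValue lam κ x := by
  have hmin : ∀ x, ∃ π ∈ allowed κ, ∀ π' ∈ allowed κ, C.value lam π x ≤ C.value lam π' x :=
    fun x => Set.exists_min_image (allowed κ) (fun π => C.value lam π x) (Set.toFinite _) h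
  choose p hp hpmin using hmin
  refine ⟨fun x => p x x, fun x => hp x x, fun x => ?_⟩
  have h1 : C.optValue lam κ x = C.value lam (p x) x :=
    le_antisymm (C.optValue_le_value lam (hp x) x) (le_iInf₂ (hpmin x))
  rw [h1, C.value_eq_lookahead]
  exact C.lookahead_mono lam (C.optValue_le_value lam (hp x)) x _

lemma isOptimal_iff [Finite A] (C : CAS S A L Sig) {lam : FeedbackProfile S A L Sig}
    {κ : AutonomyProfile S A L} {π : S × L → A × L} :
    C.IsOptimal lam κ π ↔ π ∈ allowed κ ∧ ∀ x, C.value lam π x = C.optValue lam κ x :=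
  ⟨fun h => ⟨h.1, fun x => le_antisymm (le_iInf₂ fun π' hπ' => h.2 π' hπ' x)
      (C.optValue_le_value lam h.1 x)⟩,
    fun h => ⟨h.1, fun _ hπ' x => (h.2 x).trans_le (C.optValue_le_value lam hπ' x)⟩⟩

lemma exists_isOptimal [Finite A] (C : CAS S A L Sig) (lam : FeedbackProfile S A L Sig)
    {κ : AutonomyProfile S A L} (h : (allowed κ).Nonempty) : ∃ π, C.IsOptimal lam κ π := by
  obtain ⟨π, hπ, hg⟩ := C.exists_greedy lam h
  exact ⟨π, C.isOptimal_iff.2 ⟨hπ, C.value_eq_optValue_of_greedy hπ hg⟩⟩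

open Classical in
/-- No allowed action improves on the least values. -/
lemma optValue_le_qValue [Finite A] (C : CAS S A L Sig) (lam : FeedbackProfile S A L Sig)
    {κ : AutonomyProfile S A L} (h : (allowed κ).Nonempty) {x : S × L} {u : A × L}
    (hu : u.2 ∈ κ x.1 u.1) :
    C.optValue lam κ x ≤ C.qValue lam κ x u := by
  obtain ⟨π, hπ, hg⟩ := C.exists_greedy lam h
  by_contra! hlt
  -- Switching to `u` at `x` alone keeps the policy greedy, so its values are the least ones. Its
  -- Bellman equation at `x` then contradicts the strict inequality.
  have hle : ∀ y, C.qValue lam κ y (Function.update π x u y) ≤ C.optValue lam κ y := by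
    intro y
    by_cases hy : y = x
    · subst hy; simpa using hlt.le
    · simpa [hy] using hg y
  have hmem : Function.update π x u ∈ allowed κ := by
    intro y
    by_cases hy : y = x
    · subst hy; simpa using hu
    · simpa [hy] using hπ y
  have heq := C.value_eq_optValue_of_greedy hmem hle
  have := C.value_eq_lookahead lam (Function.update π x u) x
  rw [heq x, Function.update_self] at this
  simp only [funext heq] at this
  exact absurd this hlt.ne'

end CAS

/-! ### The goal, and semicontinuity of values in the feedback profile. -/

namespace CAS

variable {S A L Sig ι : Type*} [Fintype S] [Fintype L] [Fintype Sig]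

omit [Fintype L] [Fintype Sig] in
lemma cost_pos (C : CAS S A L Sig) {x : S × L} (hx : x.1 ≠ C.goal) (u : A × L) :
    0 < C.cost x u := by
  rw [cost, if_neg hx]
  exact C.aggregate_pos x u hx

lemma lookahead_goal (C : CAS S A L Sig) (lam : FeedbackProfile S A L Sig)
    {W : S × L → ℝ≥0∞} (hW : ∀ y, y.1 = C.goal → W y = 0) {x : S × L} (hx : x.1 = C.goal)
    (u : A × L) : C.lookahead lam W x u = 0 := by
  have h : ∀ y, ENNReal.ofReal (C.transition lam x u y) * W y = 0 := by
    intro y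
    by_cases hy : y.1 = C.goal
    · rw [hW y hy, mul_zero]
    · simp [transition, hx, hy]
  simp [lookahead, h, cost, hx]

lemma stepValue_goal (C : CAS S A L Sig) (lam : FeedbackProfile S A L Sig)
    (π : S × L → A × L) (n : ℕ) {x : S × L} (hx : x.1 = C.goal) :
    C.stepValue lam π n x = 0 := by
  induction n generalizing x with
  | zero => rfl
  | succ n ih => exact C.lookahead_goal lam (fun y hy => ih hy) hx _

lemma value_goal (C : CAS S A L Sig) (lam : FeedbackProfile S A L Sig)
    (π : S × L → A × L) {x : S × L} (hx : x.1 = C.goal) : C.value lam π x = 0 := by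
  simp [value, C.stepValue_goal lam π _ hx]

lemma optValue_goal (C : CAS S A L Sig) (lam : FeedbackProfile S A L Sig)
    {κ : AutonomyProfile S A L} (h : (allowed κ).Nonempty) {x : S × L} (hx : x.1 = C.goal) :
    C.optValue lam κ x = 0 := by
  obtain ⟨π, hπ⟩ := h
  exact le_antisymm ((C.optValue_le_value lam hπ x).trans_eq (C.value_goal lam π hx)) zero_le

lemma qValue_goal (C : CAS S A L Sig) (lam : FeedbackProfile S A L Sig)
    {κ : AutonomyProfile S A L} (h : (allowed κ).Nonempty) {x : S × L} (hx : x.1 = C.goal)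
    (u : A × L) : C.qValue lam κ x u = 0 :=
  C.lookahead_goal lam (fun _ hy => C.optValue_goal lam h hy) hx u

lemma stepValue_ne_top (C : CAS S A L Sig) (lam : FeedbackProfile S A L Sig)
    (π : S × L → A × L) (n : ℕ) (x : S × L) : C.stepValue lam π n x ≠ ⊤ := by
  induction n generalizing x with
  | zero => simp [stepValue]
  | succ n ih =>
    rw [stepValue]
    exact ENNReal.add_ne_top.2 ⟨ENNReal.ofReal_ne_top, ENNReal.sum_ne_top.2 fun y _ =>
      ENNReal.mul_ne_top ENNReal.ofReal_ne_top (ih y)⟩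

-- Transitions at the goal ignore the feedback, so convergence is required only outside it.
omit [Fintype L] in
lemma tendsto_transition (C : CAS S A L Sig) {F : Filter ι}
    {lam : ι → FeedbackProfile S A L Sig} {lam' : FeedbackProfile S A L Sig} {x : S × L}
    {u : A × L} (h : x.1 ≠ C.goal → Tendsto (fun i => lam i x u) F (𝓝 (lam' x u))) (y : S × L) :
    Tendsto (fun i => C.transition (lam i) x u y) F (𝓝 (C.transition lam' x u y)) := by
  unfold transition
  split_ifs with h1 h2 h3
  · exact tendsto_const_nhds
  · exact tendsto_const_nhds
  · refine tendsto_finsetSum _ fun σ _ => Tendsto.mul_const _ ?_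
    exact tendsto_pi_nhds.1 ((continuous_subtype_val.tendsto _).comp (h h2)) σ
  · exact tendsto_const_nhds

section Limits

variable (C : CAS S A L Sig) {F : Filter ι} {lam : ι → FeedbackProfile S A L Sig}
  {lam' : FeedbackProfile S A L Sig} {π : S × L → A × L}

lemma tendsto_lookahead {W : ι → S × L → ℝ≥0∞} {W' : S × L → ℝ≥0∞} {x : S × L} {u : A × L}
    (h : ∀ y, Tendsto (fun i => C.transition (lam i) x u y) F (𝓝 (C.transition lam' x u y)))
    (hW : ∀ y, Tendsto (fun i => W i y) F (𝓝 (W' y))) (hfin : ∀ y, W' y ≠ ⊤) :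
    Tendsto (fun i => C.lookahead (lam i) (W i) x u) F (𝓝 (C.lookahead lam' W' x u)) := by
  refine tendsto_const_nhds.add (tendsto_finsetSum _ fun y _ => ?_)
  exact ENNReal.Tendsto.mul (ENNReal.tendsto_ofReal (h y)) (Or.inr (hfin y)) (hW y)
    (Or.inr ENNReal.ofReal_ne_top)

lemma tendsto_stepValue
    (h : ∀ x y, Tendsto (fun i => C.transition (lam i) x (π x) y) F
      (𝓝 (C.transition lam' x (π x) y))) (n : ℕ) (x : S × L) :
    Tendsto (fun i => C.stepValue (lam i) π n x) F (𝓝 (C.stepValue lam' π n x)) := by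
  induction n generalizing x with
  | zero => exact tendsto_const_nhds
  | succ n ih => exact C.tendsto_lookahead (h x) ih (C.stepValue_ne_top lam' π n)

/-- The value of a policy is lower semicontinuous in the feedback profile. -/
lemma eventually_lt_value
    (h : ∀ x y, Tendsto (fun i => C.transition (lam i) x (π x) y) F
      (𝓝 (C.transition lam' x (π x) y))) {x : S × L} {b : ℝ≥0∞} (hb : b < C.value lam' π x) :
    ∀ᶠ i in F, b < C.value (lam i) π x := by
  obtain ⟨n, hn⟩ := lt_iSup_iff.1 hb
  filter_upwards [(C.tendsto_stepValue h n x).eventually_const_lt hn] with i hi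
  exact hi.trans_le (le_iSup (fun n => C.stepValue (lam i) π n x) n)

/-- Since costs are positive, slight multiples of a finite value remain supersolutions of the
Bellman equation when the feedback profile is perturbed. -/
lemma eventually_value_le_mul
    (h : ∀ x y, Tendsto (fun i => C.transition (lam i) x (π x) y) F
      (𝓝 (C.transition lam' x (π x) y))) (hfin : ∀ x, C.value lam' π x ≠ ⊤) {θ : ℝ≥0∞}
    (hθ : 1 < θ) (hθ' : θ ≠ ⊤) :
    ∀ᶠ i in F, ∀ x, C.value (lam i) π x ≤ θ * C.value lam' π x := by
  have key : ∀ᶠ i in F, ∀ x,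
      C.lookahead (lam i) (fun y => θ * C.value lam' π y) x (π x) ≤ θ * C.value lam' π x := by
    refine eventually_all.2 fun x => ?_
    by_cases hx : x.1 = C.goal
    · refine Eventually.of_forall fun i => ?_
      rw [C.lookahead_goal (lam i) (fun y hy => by simp [C.value_goal lam' π hy]) hx]
      exact zero_le
    · have hW : ∀ y, θ * C.value lam' π y ≠ ⊤ := fun y => ENNReal.mul_ne_top hθ' (hfin y)
      have hlt : C.lookahead lam' (fun y => θ * C.value lam' π y) x (π x) <
          θ * C.value lam' π x := by
        have hsum : ∑ y, ENNReal.ofReal (C.transition lam' x (π x) y) * (θ * C.value lam' π y) =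
            θ * ∑ y, ENNReal.ofReal (C.transition lam' x (π x) y) * C.value lam' π y := by
          simp only [Finset.mul_sum, mul_left_comm]
        have hV := C.value_eq_lookahead lam' π x
        have hV' := hV ▸ hfin x
        unfold lookahead at hV hV' ⊢
        rw [hV, hsum, mul_add]
        -- Both sides share the finite term `θ * ∑`; what remains is `cost < θ * cost`, true because
        -- the cost is positive.
        refine ENNReal.add_lt_add_right (ENNReal.mul_ne_top hθ' (ENNReal.add_ne_top.1 hV').2) ?_
        have hpos : ENNReal.ofReal (C.cost x (π x)) ≠ 0 := by
          simpa using C.cost_pos hx (π x)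
        rw [mul_comm]
        simpa using (ENNReal.mul_lt_mul_iff_right hpos ENNReal.ofReal_ne_top).2 hθ
      have ht : Tendsto (fun i => C.lookahead (lam i) (fun y => θ * C.value lam' π y) x (π x)) F
          (𝓝 (C.lookahead lam' (fun y => θ * C.value lam' π y) x (π x))) :=
        C.tendsto_lookahead (W := fun _ y => θ * C.value lam' π y) (h x)
          (fun y => tendsto_const_nhds) hW
      exact (ht.eventually_lt_const hlt).mono fun i hi => hi.le
  filter_upwards [key] with i hi
  exact C.value_le_of_lookahead_le hi

/-- A finite value is upper semicontinuous in the feedback profile. -/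
lemma eventually_value_lt
    (h : ∀ x y, Tendsto (fun i => C.transition (lam i) x (π x) y) F
      (𝓝 (C.transition lam' x (π x) y))) (hfin : ∀ x, C.value lam' π x ≠ ⊤) {x : S × L}
    {b : ℝ≥0∞} (hb : C.value lam' π x < b) : ∀ᶠ i in F, C.value (lam i) π x < b := by
  have ht : Tendsto (fun θ : ℝ≥0∞ => θ * C.value lam' π x) (𝓝[>] 1) (𝓝 (C.value lam' π x)) := by
    have := (ENNReal.Tendsto.mul_const (tendsto_id (x := 𝓝 (1 : ℝ≥0∞)))
      (Or.inr (hfin x)) : Tendsto (fun θ : ℝ≥0∞ => id θ * C.value lam' π x) _ _)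
    rw [one_mul] at this
    exact this.mono_left nhdsWithin_le_nhds
  have hnt : ∀ᶠ θ : ℝ≥0∞ in 𝓝[>] 1, θ < ⊤ :=
    nhdsWithin_le_nhds (eventually_lt_nhds ENNReal.one_lt_top)
  have : (𝓝[>] (1 : ℝ≥0∞)).NeBot := nhdsGT_neBot_of_exists_gt ⟨⊤, ENNReal.one_lt_top⟩
  obtain ⟨θ, hθ1, hθ2, hθ3⟩ :=
    ((ht.eventually_lt_const hb).and (hnt.and self_mem_nhdsWithin)).exists
  filter_upwards [C.eventually_value_le_mul h hfin hθ3 hθ2.ne] with i hi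
  exact (hi x).trans_lt hθ1

end Limits

/-- The least values are bounded, uniformly in the feedback profile. -/
lemma WellPosed.exists_optValue_le {C : CAS S A L Sig} {κ : AutonomyProfile S A L}
    (h : C.WellPosed κ) : ∃ B : ℝ≥0∞, B ≠ ⊤ ∧ ∀ lam x, C.optValue lam κ x ≤ B := by
  suffices hK : ∃ B : ℝ≥0∞, B ≠ ⊤ ∧ ∀ lam ∈ (Set.univ : Set (FeedbackProfile S A L Sig)),
      ∀ x, C.optValue lam κ x ≤ B by
    simpa using hK
  -- Boundedness passes to subsets and finite unions. Near a given profile, a policy of finite value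
  -- there still costs at most twice as much.
  refine IsCompact.induction_on (p := fun K => ∃ B : ℝ≥0∞, B ≠ ⊤ ∧ ∀ lam ∈ K,
      ∀ x, C.optValue lam κ x ≤ B) isCompact_univ ⟨0, by simp, by simp⟩ ?_ ?_ ?_
  · rintro s t hst ⟨B, hB, hB'⟩
    exact ⟨B, hB, fun lam hl => hB' lam (hst hl)⟩
  · rintro s t ⟨B, hB, hs⟩ ⟨B', hB', ht⟩
    refine ⟨max B B', by simp [hB, hB'], ?_⟩
    rintro lam (hl | hl) x
    · exact (hs lam hl x).trans (le_max_left _ _)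
    · exact (ht lam hl x).trans (le_max_right _ _)
  · intro lam' _
    obtain ⟨π, hπ, hfin⟩ := h lam'
    have hc : ∀ x y, Tendsto (fun lam => C.transition lam x (π x) y) (𝓝 lam')
        (𝓝 (C.transition lam' x (π x) y)) := fun x y =>
      C.tendsto_transition (lam := fun lam => lam)
        (fun _ => (continuous_apply_apply x (π x)).tendsto lam') y
    refine ⟨_, nhdsWithin_le_nhds (C.eventually_value_le_mul hc hfin ENNReal.one_lt_two
      ENNReal.ofNat_ne_top), ∑ x, 2 * C.value lam' π x, ?_, ?_⟩
    · exact ENNReal.sum_ne_top.2 fun x _ => ENNReal.mul_ne_top ENNReal.ofNat_ne_top (hfin x)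
    · intro lam hl x
      exact (C.optValue_le_value lam hπ x).trans ((hl x).trans
        (Finset.single_le_sum (f := fun x => 2 * C.value lam' π x)
          (fun _ _ => zero_le) (Finset.mem_univ x)))

end CAS

/-! ### Level-optimality near the true feedback, and a bound on exploration. -/

namespace CAS

variable {S A L Sig ι : Type*} [Fintype S] [Fintype A] [Fintype L] [Fintype Sig]

omit [Fintype S] [Fintype A] [Fintype L] in
lemma allowed_mono {κ κ' : AutonomyProfile S A L} (h : ∀ s a, κ s a ⊆ κ' s a) :
    allowed κ ⊆ allowed κ' :=
  fun _ hπ x => h _ _ (hπ x)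

open Classical in
/-- If a level of competence is always allowed, the restriction to allowed levels is costless. -/
lemma optValue_eq_of_competence (C : CAS S A L Sig) (H : Human S A L Sig)
    {κ : AutonomyProfile S A L} (hne : (allowed κ).Nonempty)
    (hmeet : ∀ (x : S × L) (a : A), x.1 ≠ C.goal → ∃ l ∈ κ x.1 a, l ∈ C.competence H x a)
    (x : S × L) :
    C.optValue H.feedback κ x = C.optValue H.feedback (fun _ _ => Set.univ) x := by
  refine le_antisymm ?_ (C.optValue_anti _ (fun _ _ => Set.subset_univ _) x)
  obtain ⟨π₀, hπ₀⟩ := hne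
  have hne' : (allowed (S := S) (A := A) (L := L) fun _ _ => Set.univ).Nonempty :=
    ⟨π₀, fun _ => Set.mem_univ _⟩
  obtain ⟨π₁, -, hg⟩ := C.exists_greedy H.feedback hne'
  -- Keep the greedy action and replace its level by an allowed level of competence, which cannot
  -- raise the q-value. At the goal all q-values vanish. The unrestricted least values are then a
  -- supersolution for an allowed policy.
  have hex : ∀ y : S × L, ∃ u : A × L, u.2 ∈ κ y.1 u.1 ∧
      C.qValue H.feedback (fun _ _ => Set.univ) y u ≤
        C.optValue H.feedback (fun _ _ => Set.univ) y := by
    intro y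
    by_cases hy : y.1 = C.goal
    · exact ⟨π₀ y, hπ₀ y, by rw [C.qValue_goal _ hne' hy]; exact zero_le⟩
    · obtain ⟨l, hl, hc⟩ := hmeet y (π₁ y).1 hy
      exact ⟨((π₁ y).1, l), hl, (hc (π₁ y).2).trans (hg y)⟩
  choose π hπ hle using hex
  exact (C.optValue_le_value _ hπ x).trans (C.value_le_of_lookahead_le hle x)

/-- Such a policy attains the unrestricted least values, so its choice minimizes the unrestricted
q-value over all factored actions, in particular over the levels of the chosen action. -/
lemma IsOptimal.mem_competence {C : CAS S A L Sig} {H : Human S A L Sig}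
    {κ : AutonomyProfile S A L} {π : S × L → A × L} (hπ : C.IsOptimal H.feedback κ π)
    (hmeet : ∀ (x : S × L) (a : A), x.1 ≠ C.goal → ∃ l ∈ κ x.1 a, l ∈ C.competence H x a)
    (x : S × L) : (π x).2 ∈ C.competence H x (π x).1 := by
  intro l'
  have hV : C.value H.feedback π = C.optValue H.feedback (fun _ _ => Set.univ) :=
    funext fun y => ((C.isOptimal_iff.1 hπ).2 y).trans
      (C.optValue_eq_of_competence H ⟨π, hπ.1⟩ hmeet y)
  have hq : C.qValue H.feedback (fun _ _ => Set.univ) x (π x) =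
      C.optValue H.feedback (fun _ _ => Set.univ) x := by
    have := C.value_eq_lookahead H.feedback π x
    rw [hV] at this
    exact this.symm
  exact hq.trans_le (C.optValue_le_qValue _ ⟨π, fun _ => Set.mem_univ _⟩ (Set.mem_univ _))

/-- Policies that are optimal for nearby feedback profiles are optimal in the limit. -/
lemma eventually_isOptimal_imp (C : CAS S A L Sig) {F : Filter ι}
    {lam : ι → FeedbackProfile S A L Sig} {lam' : FeedbackProfile S A L Sig}
    {κ : AutonomyProfile S A L}
    (hlam : ∀ x : S × L, x.1 ≠ C.goal → ∀ a, ∀ l ∈ κ x.1 a,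
      Tendsto (fun i => lam i x (a, l)) F (𝓝 (lam' x (a, l))))
    (hfin : ∃ π ∈ allowed κ, ∀ x, C.value lam' π x ≠ ⊤) :
    ∀ᶠ i in F, ∀ π, C.IsOptimal (lam i) κ π → C.IsOptimal lam' κ π := by
  obtain ⟨π₀, hπ₀, hfin₀⟩ := hfin
  obtain ⟨πo, ho⟩ := C.exists_isOptimal lam' ⟨π₀, hπ₀⟩
  have htr : ∀ π ∈ allowed κ, ∀ x y, Tendsto (fun i => C.transition (lam i) x (π x) y) F
      (𝓝 (C.transition lam' x (π x) y)) := fun π hπ x y =>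
    C.tendsto_transition (fun hx => hlam x hx _ _ (hπ x)) y
  refine eventually_all.2 fun π => ?_
  by_cases hπ : π ∈ allowed κ
  · by_cases hopt : C.IsOptimal lam' κ π
    · exact Eventually.of_forall fun _ _ => hopt
    · have hlt : ∃ x, C.value lam' πo x < C.value lam' π x := by
        by_contra! hle
        exact hopt ⟨hπ, fun π' hπ' x => (hle x).trans (ho.2 π' hπ' x)⟩
      obtain ⟨x, hx⟩ := hlt
      -- The threshold `b` separates the two values under perturbation: upper semicontinuity applies
      -- to the finite `πo`, lower semicontinuity to `π`, whose value may be infinite.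
      obtain ⟨b, hb, hb'⟩ := exists_between hx
      filter_upwards [C.eventually_value_lt (htr πo ho.1)
        (fun y => ne_top_of_le_ne_top (hfin₀ y) (ho.2 π₀ hπ₀ y)) hb,
        C.eventually_lt_value (htr π hπ) hb'] with i h1 h2 hi
      exact absurd (hi.2 πo ho.1 x) (h1.trans h2).not_ge
  · exact Eventually.of_forall fun _ h => absurd h.1 hπ

lemma eventually_levelOptimal (C : CAS S A L Sig) (H : Human S A L Sig) {F : Filter ι}
    {lam : ι → FeedbackProfile S A L Sig} {κ : AutonomyProfile S A L}
    (hlam : ∀ x : S × L, x.1 ≠ C.goal → ∀ a, ∀ l ∈ κ x.1 a,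
      Tendsto (fun i => lam i x (a, l)) F (𝓝 (H.feedback x (a, l))))
    (hfin : ∃ π ∈ allowed κ, ∀ x, C.value H.feedback π x ≠ ⊤)
    (hmeet : ∀ (x : S × L) (a : A), x.1 ≠ C.goal → ∃ l ∈ κ x.1 a, l ∈ C.competence H x a) :
    ∀ᶠ i in F, C.LevelOptimal H (lam i) κ := by
  filter_upwards [C.eventually_isOptimal_imp hlam hfin] with i hi
  obtain ⟨π₀, hπ₀, -⟩ := hfin
  exact ⟨C.exists_isOptimal _ ⟨π₀, hπ₀⟩, fun π hπ x => (hi π hπ).mem_competence hmeet x⟩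

/-- Lower bound for the probability of proposing an adjacent level. -/
lemma WellPosed.exists_le_exploreProb {C : CAS S A L Sig} {κ₀ : AutonomyProfile S A L}
    (h : C.WellPosed κ₀) {η : ℝ} (hη : 0 < η) :
    ∃ δ : ℝ, 0 < δ ∧ ∀ (lam : FeedbackProfile S A L Sig) (κ : AutonomyProfile S A L),
      (∀ s a, κ₀ s a ⊆ κ s a) → ∀ (x : S × L) (a : A) (l : L), C.graph.Adj x.2 l →
        δ ≤ C.exploreProb η lam κ x a l := by
  classical
  obtain ⟨B, hB, hle⟩ := h.exists_optValue_le
  -- A crude bound for all q-values: every cost is at most the sum of all costs, and each transition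
  -- probability is at most one.
  set M : ℝ≥0∞ := (∑ x : S × L, ∑ u : A × L, ENNReal.ofReal (C.cost x u)) +
    ∑ _y : S × L, B with hM
  have hMtop : M ≠ ⊤ := by
    refine ENNReal.add_ne_top.2 ⟨?_, ENNReal.sum_ne_top.2 fun _ _ => hB⟩
    exact ENNReal.sum_ne_top.2 fun _ _ => ENNReal.sum_ne_top.2 fun _ _ => ENNReal.ofReal_ne_top
  have htr : ∀ lam x u y, C.transition lam x u y ≤ 1 := by
    intro lam x u y
    unfold transition
    split_ifs
    · exact le_rfl
    · exact zero_le_one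
    · have h1 := (lam x u).2
      calc _ ≤ ∑ σ, (lam x u : Sig → ℝ) σ * 1 := by
            refine Finset.sum_le_sum fun σ _ => mul_le_mul_of_nonneg_left ?_ (h1.1 σ)
            have h2 := (C.trans u.2 σ x.1 u.1).2
            exact h2.2 ▸ Finset.single_le_sum (fun z _ => h2.1 z) (Finset.mem_univ y.1)
        _ = 1 := by simp
    · exact zero_le_one
  have hq : ∀ lam κ, (∀ s a, κ₀ s a ⊆ κ s a) → ∀ x u, C.qValue lam κ x u ≤ M := by
    intro lam κ hκ x u
    refine add_le_add ?_ (Finset.sum_le_sum fun y _ => ?_)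
    · exact (Finset.single_le_sum (f := fun u => ENNReal.ofReal (C.cost x u))
        (fun _ _ => zero_le) (Finset.mem_univ u)).trans
        (Finset.single_le_sum (f := fun x => ∑ u : A × L, ENNReal.ofReal (C.cost x u))
        (fun _ _ => zero_le) (Finset.mem_univ x))
    · calc _ ≤ 1 * B := mul_le_mul' (by simpa using htr lam x u y)
            ((C.optValue_anti lam hκ y).trans (hle lam y))
        _ = B := one_mul B
  have hL : 0 < (Fintype.card L : ℝ) := by
    exact_mod_cast Fintype.card_pos_iff.2 ⟨C.start.2⟩
  -- The softmax numerator is at least `exp (-M)`; q-values are nonnegative, so each summand of the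
  -- denominator is at most one.
  refine ⟨η * (Real.exp (-M.toReal) / Fintype.card L), by positivity, ?_⟩
  intro lam κ hκ x a l hl
  rw [exploreProb, if_pos hl]
  refine mul_le_mul_of_nonneg_left ?_ hη.le
  have hpos : 0 < ∑ l'' with C.graph.Adj x.2 l'',
      Real.exp (-(C.qValue lam κ x (a, l'')).toReal) :=
    Finset.sum_pos (fun _ _ => Real.exp_pos _) ⟨l, by simpa using hl⟩
  refine div_le_div₀ (Real.exp_pos _).le ?_ hpos ?_
  · exact Real.exp_le_exp.2 (neg_le_neg (ENNReal.toReal_mono hMtop (hq lam κ hκ x _)))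
  · calc _ ≤ ∑ l'' with C.graph.Adj x.2 l'', (1 : ℝ) := by
          refine Finset.sum_le_sum fun l'' _ => ?_
          rw [Real.exp_le_one_iff]
          simp
      _ ≤ Fintype.card L := by
          rw [Finset.sum_const, nsmul_eq_mul, mul_one]
          exact_mod_cast Finset.card_le_univ _

end CAS

/-! ### From conditional to unconditional probabilities. -/

lemma setIntegral_condProb {Ω : Type*} {m mΩ : MeasurableSpace Ω} {μ : Measure Ω}
    [IsFiniteMeasure μ] (hm : m ≤ mΩ) {s t : Set Ω} (hs : MeasurableSet[m] s)
    (ht : MeasurableSet t) : ∫ ω in s, (μ⟦t | m⟧) ω ∂μ = μ.real (s ∩ t) := by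
  rw [setIntegral_condExp hm ((integrable_const 1).indicator ht) hs,
    setIntegral_indicator ht, setIntegral_const, smul_eq_mul, mul_one]

lemma mul_measureReal_le_of_le_condProb {Ω : Type*} {m mΩ : MeasurableSpace Ω} {μ : Measure Ω}
    [IsFiniteMeasure μ] (hm : m ≤ mΩ) {s t : Set Ω} (hs : MeasurableSet[m] s)
    (ht : MeasurableSet t) {δ : ℝ} (h : ∀ᵐ ω ∂μ, ω ∈ s → δ ≤ (μ⟦t | m⟧) ω) :
    δ * μ.real s ≤ μ.real (s ∩ t) := by
  rw [← setIntegral_condProb hm hs ht, mul_comm, ← smul_eq_mul, ← setIntegral_const]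
  exact setIntegral_mono_on_ae (integrable_const δ).integrableOn
    integrable_condExp.integrableOn (hm s hs) h

lemma measure_inter_eq_zero_of_condProb {Ω : Type*} {m mΩ : MeasurableSpace Ω} {μ : Measure Ω}
    [IsFiniteMeasure μ] (hm : m ≤ mΩ) {s t : Set Ω} (hs : MeasurableSet[m] s)
    (ht : MeasurableSet t) (h : ∀ᵐ ω ∂μ, ω ∈ s → (μ⟦t | m⟧) ω = 0) : μ (s ∩ t) = 0 := by
  have : μ.real (s ∩ t) = 0 := by
    rw [← setIntegral_condProb hm hs ht]
    exact setIntegral_eq_zero_of_ae_eq_zero h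
  exact (measureReal_eq_zero_iff).1 this

/-! ### Growth of the autonomy profile along a run. -/

namespace RunData

variable {S A L Sig Ω : Type*} [Fintype Sig] (R : RunData S A L Sig Ω) (κ₀ : AutonomyProfile S A L)

lemma kappa_mono (ω : Ω) (s : S) (a : A) : Monotone fun t => R.kappa κ₀ t ω s a :=
  monotone_nat_of_le_succ fun _ _ hl => Or.inl hl

lemma subset_kappa (t : ℕ) (ω : Ω) (s : S) (a : A) : κ₀ s a ⊆ R.kappa κ₀ t ω s a :=
  R.kappa_mono κ₀ ω s a (Nat.zero_le t)

/-- The profile at time `t` depends only on earlier proposals and answers, so one may condition on a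
level being still missing. -/
lemma measurableSet_kappa [Fintype S] [Fintype L] {ℱ : ℕ → MeasurableSpace Ω} (hmono : Monotone ℱ)
    (hstate : ∀ t x, MeasurableSet[ℱ t] {ω | R.state t ω = x})
    (hact : ∀ t a, MeasurableSet[ℱ t] {ω | R.act t ω = a})
    (hpropose : ∀ t l, MeasurableSet[ℱ (t + 1)] {ω | R.propose t ω = l})
    (hanswer : ∀ t b, MeasurableSet[ℱ (t + 1)] {ω | R.answer t ω = b})
    (t : ℕ) (s : S) (a : A) (l : L) : MeasurableSet[ℱ t] {ω | l ∈ R.kappa κ₀ t ω s a} := by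
  induction t with
  | zero => exact MeasurableSet.const _
  | succ t ih =>
    have hs : MeasurableSet[ℱ (t + 1)] {ω | (R.state t ω).1 = s} := by
      have : {ω | (R.state t ω).1 = s} = ⋃ l : L, {ω | R.state t ω = (s, l)} := by
        ext ω
        simp [Prod.ext_iff]
      rw [this]
      exact MeasurableSet.iUnion fun l => hmono t.le_succ _ (hstate t _)
    exact (hmono t.le_succ _ ih).union (hs.inter ((hmono t.le_succ _ (hact t a)).inter
      ((hpropose t _).inter (hanswer t _))))

end RunData

namespace IsGatedRun

variable {S A L Sig Ω : Type*} [Fintype S] [Fintype A] [Fintype L] [Fintype Sig]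
  {mΩ : MeasurableSpace Ω} {C : CAS S A L Sig} {H : Human S A L Sig} {η : ℝ}
  {κ₀ : AutonomyProfile S A L} {lam₀ : FeedbackProfile S A L Sig} {μ : Measure Ω}
  {R : RunData S A L Sig Ω}

/-- The part of `exists_history` that concerns proposals and permissions, with the measurability of
the autonomy profile. -/
lemma exists_history_kappa (hR : IsGatedRun C H η κ₀ lam₀ μ R) :
    ∃ ℱ 𝒢 : ℕ → MeasurableSpace Ω, (∀ t, ℱ t ≤ 𝒢 t) ∧ (∀ t, 𝒢 t ≤ mΩ) ∧
      (∀ t x a l, MeasurableSet[ℱ t]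
        {ω | R.state t ω = x ∧ R.act t ω = a ∧ l ∉ R.kappa κ₀ t ω x.1 a}) ∧
      (∀ t s a l, MeasurableSet[ℱ t] {ω | l ∈ R.kappa κ₀ t ω s a}) ∧
      (∀ t l, MeasurableSet[𝒢 t] {ω | R.propose t ω = l}) ∧
      (∀ t, MeasurableSet {ω | R.answer t ω = true}) ∧
      (∀ t l, ∀ᵐ ω ∂μ, (μ⟦{ω' | R.propose t ω' = some l} | ℱ t⟧) ω =
        C.exploreProb η (R.lam t ω) (R.kappa κ₀ t ω) (R.state t ω) (R.act t ω) l) ∧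
      (∀ t l, ∀ᵐ ω ∂μ, R.propose t ω = some l →
        l ∉ R.kappa κ₀ t ω (R.state t ω).1 (R.act t ω) →
        (μ⟦{ω' | R.answer t ω' = true} | 𝒢 t⟧) ω = H.allow (R.state t ω).1 (R.act t ω) l) := by
  obtain ⟨ℱ, 𝒢, ℋ, hle, hstate, hact, -, -, hpropose, hanswer, -, hexp, hall, -⟩ :=
    hR.exists_history
  have hmono : Monotone ℱ := monotone_nat_of_le_succ fun t =>
    (hle t).1.trans ((hle t).2.1.trans (hle t).2.2.1)
  have hκ := R.measurableSet_kappa κ₀ hmono hstate hact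
    (fun t l => ((hle t).2.1.trans (hle t).2.2.1) _ (hpropose t l))
    (fun t b => (hle t).2.2.1 _ (hanswer t b))
  exact ⟨ℱ, 𝒢, fun t => (hle t).1, fun t => (hle t).2.2.2.2.1,
    fun t x a l => (hstate t x).inter ((hact t a).inter (hκ t x.1 a l).compl), hκ, hpropose,
    fun t => (hle t).2.2.2.2.2 _ (hanswer t true), hexp, hall⟩

variable [IsProbabilityMeasure μ]

/-- Almost surely, no level is added that the human never allows. -/
lemma ae_kappa_subset (hR : IsGatedRun C H η κ₀ lam₀ μ R) :
    ∀ᵐ ω ∂μ, ∀ t s a, R.kappa κ₀ t ω s a ⊆ κ₀ s a ∪ H.kappaH s a := by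
  obtain ⟨ℱ, 𝒢, hℱ, h𝒢, hE, -, hprop, hans, -, hall⟩ := hR.exists_history_kappa
  have hno : ∀ᵐ ω ∂μ, ∀ t x a l, l ∉ H.kappaH x.1 a →
      ¬ (((R.state t ω = x ∧ R.act t ω = a ∧ l ∉ R.kappa κ₀ t ω x.1 a) ∧
        R.propose t ω = some l) ∧ R.answer t ω = true) := by
    refine ae_all_iff.2 fun t => ae_all_iff.2 fun x => ae_all_iff.2 fun a => ae_all_iff.2 fun l => ?_
    by_cases hl : l ∈ H.kappaH x.1 a
    · exact ae_of_all _ fun _ h => absurd hl h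
    have hzero : H.allow x.1 a l = 0 := le_antisymm (not_lt.1 hl) (H.allow_nonneg _ _ _)
    have hnull := measure_inter_eq_zero_of_condProb (μ := μ) (h𝒢 t)
      ((hℱ t _ (hE t x a l)).inter (hprop t (some l))) (hans t) (by
        filter_upwards [hall t l] with ω h1 h2
        obtain ⟨⟨hx, ha, hk⟩, hp⟩ := h2
        rw [h1 hp (by rw [hx, ha]; exact hk), hx, ha, hzero])
    filter_upwards [measure_eq_zero_iff_ae_notMem.1 hnull] with ω h1 _ h2
    exact h1 h2
  filter_upwards [hno] with ω h t s a
  induction t with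
  | zero => exact Set.subset_union_left
  | succ t ih =>
    rintro l (hl | ⟨hs, ha, hp, hb⟩)
    · exact ih hl
    · by_contra hcon
      have hcon' : l ∉ H.kappaH (R.state t ω).1 a := fun h => hcon (Or.inr (hs ▸ h))
      -- The permission law covers only levels not yet allowed; one already allowed is handled by
      -- the induction hypothesis.
      refine h t (R.state t ω) a l hcon' ⟨⟨⟨rfl, ha, fun hk => hcon (ih ?_)⟩, hp⟩, hb⟩
      exact hs ▸ hk

/-- Almost surely, an action is performed only finitely often at a level adjacent to one that the
human may allow but has not allowed yet. -/
lemma ae_eventually_mem_kappa (hR : IsGatedRun C H η κ₀ lam₀ μ R) (hη : 0 < η)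
    (hwp : C.WellPosed κ₀) {x : S × L} {a : A} {l : L} (hadj : C.graph.Adj x.2 l)
    (hl : l ∈ H.kappaH x.1 a) :
    ∀ᵐ ω ∂μ, ∀ᶠ t in atTop, ¬ (R.state t ω = x ∧ R.act t ω = a ∧ l ∉ R.kappa κ₀ t ω x.1 a) := by
  obtain ⟨ℱ, 𝒢, hℱ, h𝒢, hE, -, hprop, hans, hexp, hall⟩ := hR.exists_history_kappa
  obtain ⟨δ, hδ, hδle⟩ := hwp.exists_le_exploreProb hη
  set E : ℕ → Set Ω := fun t =>
    {ω | R.state t ω = x ∧ R.act t ω = a ∧ l ∉ R.kappa κ₀ t ω x.1 a} with hEdef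
  set P : ℕ → Set Ω := fun t => {ω | R.propose t ω = some l}
  set Y : ℕ → Set Ω := fun t => {ω | R.answer t ω = true}
  have hpos : 0 < H.allow x.1 a l := hl
  have hEm : ∀ t, MeasurableSet (E t) := fun t => (hℱ t).trans (h𝒢 t) _ (hE t x a l)
  have hPm : ∀ t, MeasurableSet (P t) := fun t => h𝒢 t _ (hprop t _)
  have h1 : ∀ t, δ * μ.real (E t) ≤ μ.real (E t ∩ P t) := fun t =>
    mul_measureReal_le_of_le_condProb ((hℱ t).trans (h𝒢 t)) (hE t x a l) (hPm t) (by
      filter_upwards [hexp t l] with ω h1 h2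
      obtain ⟨hx, ha, -⟩ := h2
      rw [h1]
      exact hδle _ _ (R.subset_kappa κ₀ t ω) _ _ _ (by rwa [hx]))
  have h2 : ∀ t, H.allow x.1 a l * μ.real (E t ∩ P t) ≤ μ.real (E t ∩ P t ∩ Y t) := fun t =>
    mul_measureReal_le_of_le_condProb (h𝒢 t) ((hℱ t _ (hE t x a l)).inter (hprop t _)) (hans t) (by
      filter_upwards [hall t l] with ω h1 h2
      obtain ⟨⟨hx, ha, hk⟩, hp⟩ := h2
      rw [h1 hp (by rw [hx, ha]; exact hk), hx, ha])
  -- A success adds `l` for good, which excludes `E t'` at all later times.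
  have hdisj : Pairwise (Function.onFun (AEDisjoint μ) fun t => E t ∩ P t ∩ Y t) := by
    have hlt : ∀ t t', t < t' → Disjoint (E t ∩ P t ∩ Y t) (E t' ∩ P t' ∩ Y t') := by
      intro t t' htt
      refine Set.disjoint_left.2 fun ω hω hω' => ?_
      obtain ⟨⟨⟨hx, ha, -⟩, hp⟩, hy⟩ := hω
      refine hω'.1.1.2.2 (R.kappa_mono κ₀ ω x.1 a htt (Or.inr ⟨by rw [hx], ha, hp, hy⟩))
    intro t t' hne
    rcases lt_or_gt_of_ne hne with h | h
    · exact (hlt t t' h).aedisjoint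
    · exact (hlt t' t h).symm.aedisjoint
  have hsum := tsum_measure_le_measure_univ
    (fun t => (((hEm t).inter (hPm t)).inter (hans t)).nullMeasurableSet) hdisj
  set c := H.allow x.1 a l * δ
  have hc : 0 < c := mul_pos hpos hδ
  have hle : ∀ t, μ (E t) ≤ (ENNReal.ofReal c)⁻¹ * μ (E t ∩ P t ∩ Y t) := by
    intro t
    have h3 : c * μ.real (E t) ≤ μ.real (E t ∩ P t ∩ Y t) := by
      calc c * μ.real (E t) = H.allow x.1 a l * (δ * μ.real (E t)) := mul_assoc _ _ _
        _ ≤ _ := (mul_le_mul_of_nonneg_left (h1 t) hpos.le).trans (h2 t)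
    rw [← ENNReal.mul_le_iff_le_inv (by simpa using hc) ENNReal.ofReal_ne_top]
    rw [← ofReal_measureReal (μ := μ) (s := E t),
      ← ofReal_measureReal (μ := μ) (s := E t ∩ P t ∩ Y t), ← ENNReal.ofReal_mul hc.le]
    exact ENNReal.ofReal_le_ofReal h3
  -- Successes are disjoint, so their probabilities have a finite sum, hence so do those of `E t`.
  -- This half of Borel–Cantelli needs no independence.
  refine ae_eventually_notMem (μ := μ) (s := E) (ne_top_of_le_ne_top ?_ (ENNReal.tsum_le_tsum hle))
  rw [ENNReal.tsum_mul_left]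
  exact ENNReal.mul_ne_top (ENNReal.inv_ne_top.2 (by simpa using hc))
    (ne_top_of_le_ne_top (measure_ne_top μ _) hsum)

/-- Almost surely, the system eventually allows every level that is connected to an allowed one by
a path of levels that the human may allow. -/
lemma ae_exists_mem_kappa_of_walk (hR : IsGatedRun C H η κ₀ lam₀ μ R) (hη : 0 < η)
    (hwp : C.WellPosed κ₀)
    (hstarve : ∀ᵐ ω ∂μ, ∀ (s : S) (l : L) (a : A), s ≠ C.goal → R.NotStarved κ₀ ω (s, l) a) :
    ∀ᵐ ω ∂μ, ∀ s, s ≠ C.goal → ∀ a l₀ l₁, ∀ p : C.graph.Walk l₀ l₁,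
      (∀ v ∈ p.support, v ∈ H.kappaH s a) → (∃ t, l₀ ∈ R.kappa κ₀ t ω s a) →
      ∃ t, l₁ ∈ R.kappa κ₀ t ω s a := by
  have hstep : ∀ᵐ ω ∂μ, ∀ (x : S × L) (a : A) (l : L), C.graph.Adj x.2 l → l ∈ H.kappaH x.1 a →
      ∀ᶠ t in atTop, ¬ (R.state t ω = x ∧ R.act t ω = a ∧ l ∉ R.kappa κ₀ t ω x.1 a) := by
    refine ae_all_iff.2 fun x => ae_all_iff.2 fun a => ae_all_iff.2 fun l => ?_
    by_cases h : C.graph.Adj x.2 l ∧ l ∈ H.kappaH x.1 a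
    · filter_upwards [hR.ae_eventually_mem_kappa hη hwp h.1 h.2] with ω hω _ _ using hω
    · exact ae_of_all _ fun _ h1 h2 => absurd ⟨h1, h2⟩ h
  filter_upwards [hstep, hstarve] with ω hω hns s hs a l₀ l₁ p
  induction p with
  | nil => exact fun _ h => h
  | @cons u v w huv p ih =>
    intro hsup hu
    refine ih (fun z hz => hsup z (by simp [hz])) ?_
    have hv : v ∈ H.kappaH s a := hsup v (by simp)
    -- Once `u` is allowed, `a` recurs in `(s, u)`, whereas only finitely many of these visits can
    -- find `v` missing.
    obtain ⟨t, ⟨hx, ha⟩, hnot⟩ := ((hns s u a hs hu).and_eventually (hω (s, u) a v huv hv)).exists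
    by_contra hcon
    exact hnot ⟨hx, ha, fun hk => hcon ⟨t, hk⟩⟩

end IsGatedRun

/-! ### Convergence in probability and conclusion. -/

/-- Convergence in distribution to a constant implies convergence in probability. -/
lemma tendsto_measure_le_dist_of_tendstoInDistribution_const {Ω E : Type*} [MeasurableSpace Ω]
    {μ : Measure Ω} [IsProbabilityMeasure μ] [PseudoMetricSpace E] [MeasurableSpace E]
    [OpensMeasurableSpace E] {X : ℕ → Ω → E} {c : E}
    (h : TendstoInDistribution X atTop (fun _ : Ω => c) (fun _ => μ) μ) {ε : ℝ} (hε : 0 < ε) :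
    Tendsto (fun t => μ {ω | ε ≤ dist (X t ω) c}) atTop (𝓝 0) := by
  have hcl : IsClosed {y : E | ε ≤ dist y c} :=
    isClosed_le continuous_const (continuous_id.dist continuous_const)
  -- Portmanteau for a closed set that the limiting point mass does not charge.
  have hlim := ProbabilityMeasure.limsup_measure_closed_le_of_tendsto h.tendsto hcl
  have h0 : (μ.map fun _ : Ω => c) {y : E | ε ≤ dist y c} = 0 := by
    rw [Measure.map_apply measurable_const hcl.measurableSet]
    simp [hε.not_ge]
  have hX : ∀ t, (μ.map (X t)) {y : E | ε ≤ dist y c} = μ {ω | ε ≤ dist (X t ω) c} := fun t =>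
    Measure.map_apply_of_aemeasurable (h.forall_aemeasurable t) hcl.measurableSet
  simp only [ProbabilityMeasure.coe_mk, h0, hX] at hlim
  exact tendsto_of_le_liminf_of_limsup_le zero_le hlim

theorem theorem1 {S A L Sig Ω : Type*} [Fintype S] [Fintype A] [Fintype L] [Fintype Sig]
    [MeasurableSpace Ω] (μ : Measure Ω) [IsProbabilityMeasure μ]
    (C : CAS S A L Sig) (H : Human S A L Sig) (η : ℝ) (hη : 0 < η) (hη' : η ≤ 1)
    (κ₀ : AutonomyProfile S A L) (hwp : C.WellPosed κ₀)
    (hpath : ∀ (s : S) (l : L) (a : A), s ≠ C.goal →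
      ∃ l₀ ∈ κ₀ s a, ∃ l₁ ∈ C.competence H (s, l) a, ∃ p : C.graph.Walk l₀ l₁,
        ∀ v ∈ p.support, v ∈ H.kappaH s a)
    (lam₀ : FeedbackProfile S A L Sig) (R : RunData S A L Sig Ω)
    (hR : IsGatedRun C H η κ₀ lam₀ μ R)
    (hstarve : ∀ᵐ ω ∂μ, ∀ (s : S) (l : L) (a : A), s ≠ C.goal → R.NotStarved κ₀ ω (s, l) a)
    (hconv : ∀ (s : S) (l : L) (a : A), s ≠ C.goal → ∀ l' ∈ κ₀ s a ∪ H.kappaH s a,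
      TendstoInDistribution (fun t ω => R.lam t ω (s, l) (a, l')) atTop
        (fun _ : Ω => H.feedback (s, l) (a, l')) (fun _ => μ) μ) :
    Tendsto (fun t => μ {ω | ¬ C.LevelOptimal H (R.lam t ω) (R.kappa κ₀ t ω)}) atTop (𝓝 0) := by
  classical
  -- the coordinates of the feedback profile that matter
  let J := {j : (S × L) × (A × L) // j.1.1 ≠ C.goal ∧ j.2.2 ∈ κ₀ j.1.1 j.2.1 ∪ H.kappaH j.1.1 j.2.1}
  let res : FeedbackProfile S A L Sig → J → stdSimplex ℝ Sig := fun lam j => lam j.1.1 j.1.2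
  -- Nearness is measured only on the coordinates in `J`; no convergence is assumed on the others.
  let F : Filter (FeedbackProfile S A L Sig) := comap res (𝓝 (res H.feedback))
  let Meets : AutonomyProfile S A L → Prop := fun κ =>
    ∀ (x : S × L) (a : A), x.1 ≠ C.goal → ∃ l ∈ κ x.1 a, l ∈ C.competence H x a
  -- There are finitely many autonomy profiles, so one neighbourhood serves all values of the random
  -- `κ`.
  have hF : ∀ᶠ lam in F, ∀ κ : AutonomyProfile S A L, (∀ s a, κ₀ s a ⊆ κ s a) →
      (∀ s a, κ s a ⊆ κ₀ s a ∪ H.kappaH s a) → Meets κ → C.LevelOptimal H lam κ := by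
    refine eventually_all.2 fun κ => ?_
    by_cases hκ : (∀ s a, κ₀ s a ⊆ κ s a) ∧ (∀ s a, κ s a ⊆ κ₀ s a ∪ H.kappaH s a) ∧ Meets κ
    · obtain ⟨π, hπ, hfin⟩ := hwp H.feedback
      refine (C.eventually_levelOptimal (lam := fun lam => lam) H (fun x hx a l hl => ?_)
        ⟨π, CAS.allowed_mono hκ.1 hπ, hfin⟩ hκ.2.2).mono fun _ h _ _ _ => h
      exact tendsto_pi_nhds.1 (tendsto_comap (f := res) (x := 𝓝 (res H.feedback)))
        ⟨(x, (a, l)), hx, hκ.2.1 _ _ hl⟩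
    · exact Eventually.of_forall fun _ h1 h2 h3 => absurd ⟨h1, h2, h3⟩ hκ
  obtain ⟨ε, hε, hball⟩ := Metric.eventually_nhds_iff.1 (eventually_comap.1 hF)
  have hae : ∀ᵐ ω ∂μ, ∃ t, Meets (R.kappa κ₀ t ω) := by
    filter_upwards [hR.ae_exists_mem_kappa_of_walk hη hwp hstarve] with ω hω
    have hex : ∀ (x : S × L) (a : A), ∃ t, x.1 ≠ C.goal →
        ∃ l ∈ R.kappa κ₀ t ω x.1 a, l ∈ C.competence H x a := by
      rintro ⟨s, l⟩ a
      by_cases hs : s = C.goal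
      · exact ⟨0, fun h => absurd hs h⟩
      · obtain ⟨l₀, h0, l₁, h1, p, hp⟩ := hpath s l a hs
        obtain ⟨t, ht⟩ := hω s hs a l₀ l₁ p hp ⟨0, h0⟩
        exact ⟨t, fun _ => ⟨l₁, ht, h1⟩⟩
    choose T hT using hex
    obtain ⟨N, hN⟩ := Finite.exists_le fun j : (S × L) × A => T j.1 j.2
    refine ⟨N, fun x a hx => ?_⟩
    obtain ⟨l, hl, hc⟩ := hT x a hx
    exact ⟨l, R.kappa_mono κ₀ ω x.1 a (hN (x, a)) hl, hc⟩
  have hbad : Tendsto (fun t => μ {ω | ¬ Meets (R.kappa κ₀ t ω)}) atTop (𝓝 0) := by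
    obtain ⟨ℱ, 𝒢, hℱ, h𝒢, -, hκ, -⟩ := hR.exists_history_kappa
    have hm : ∀ t, MeasurableSet {ω | ¬ Meets (R.kappa κ₀ t ω)} := by
      intro t
      refine MeasurableSet.compl ?_
      have : {ω | Meets (R.kappa κ₀ t ω)} = ⋂ (x : S × L) (a : A) (_ : x.1 ≠ C.goal),
          ⋃ (l : L) (_ : l ∈ C.competence H x a), {ω | l ∈ R.kappa κ₀ t ω x.1 a} := by
        ext ω
        simp only [Set.mem_ofPred_eq, Set.mem_iInter, Set.mem_iUnion, Meets, exists_prop]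
        simp only [and_comm]
      change MeasurableSet {ω | Meets (R.kappa κ₀ t ω)}
      rw [this]
      exact .iInter fun x => .iInter fun a => .iInter fun _ => .iUnion fun l => .iUnion fun _ =>
        (hℱ t).trans (h𝒢 t) _ (hκ t _ _ _)
    -- Levels are never removed, so the bad events decrease to a null set and continuity from above
    -- applies.
    have hanti : Antitone fun t => {ω | ¬ Meets (R.kappa κ₀ t ω)} := by
      intro t t' htt ω hω hmeet
      refine hω fun x a hx => ?_
      obtain ⟨l, hl, hc⟩ := hmeet x a hx
      exact ⟨l, R.kappa_mono κ₀ ω x.1 a htt hl, hc⟩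
    have hlim := tendsto_measure_iInter_atTop (μ := μ) (fun t => (hm t).nullMeasurableSet) hanti
      ⟨0, measure_ne_top μ _⟩
    have hnull : μ (⋂ t, {ω | ¬ Meets (R.kappa κ₀ t ω)}) = 0 := by
      refine measure_eq_zero_iff_ae_notMem.2 (hae.mono fun ω hω h => ?_)
      obtain ⟨t, ht⟩ := hω
      exact Set.mem_iInter.1 h t ht
    rwa [hnull] at hlim
  have hlam : Tendsto (fun t => ∑ j : J, μ {ω | ε ≤ dist (res (R.lam t ω) j) (res H.feedback j)})
      atTop (𝓝 0) := by
    rw [← Finset.sum_const_zero (s := (Finset.univ : Finset J))]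
    refine tendsto_finsetSum _ fun j _ => ?_
    obtain ⟨⟨⟨s, l⟩, ⟨a, l'⟩⟩, hs, hl'⟩ := j
    exact tendsto_measure_le_dist_of_tendstoInDistribution_const (hconv s l a hs l' hl') hε
  have hsum := hbad.add hlam
  rw [add_zero] at hsum
  refine tendsto_of_tendsto_of_tendsto_of_le_of_le tendsto_const_nhds hsum
    (fun _ => zero_le) fun t => ?_
  -- Only monotonicity and subadditivity of `μ` are used, so neither measurability of this event nor
  -- any independence of `λ` and `κ` is needed.
  calc μ {ω | ¬ C.LevelOptimal H (R.lam t ω) (R.kappa κ₀ t ω)}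
      ≤ μ ({ω | ¬ Meets (R.kappa κ₀ t ω)} ∪
          ⋃ j : J, {ω | ε ≤ dist (res (R.lam t ω) j) (res H.feedback j)}) := by
        refine measure_mono_ae (hR.ae_kappa_subset.mono fun ω hω hnot => ?_)
        change ω ∈ (_ ∪ _ : Set Ω)
        by_contra hcon
        simp only [Set.mem_ofPred_eq, Set.mem_union, Set.mem_iUnion, not_or, not_exists,
          not_le, not_not] at hcon
        exact hnot (hball ((dist_pi_lt_iff hε).2 hcon.2) _ rfl _ (R.subset_kappa κ₀ t ω)
          (hω t) hcon.1)
    _ ≤ _ := (measure_union_le _ _).trans (by gcongr; exact measure_iUnion_fintype_le _ _)
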